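/- Let $\mathcal X$ be a complex Banach space and let $T$ be a bounded linear operator on $\mathcal X$. Write $T-\lambda$ for $T-\lambda I$. An operator is bounded below if it is injective and has closed range. Let $\sigma_a(T)=\{\lambda\in\mathbb C: T-\lambda \text{ is not bounded below}\}$, and let $\mathrm{iso}\,\sigma_a(T)$ be the set of points of $\sigma_a(T)$ that are not limit points of $\sigma_a(T)$. The ascent $\mathrm{asc}(S)$ of an operator $S$ is the least integer $n\ge 0$ with $S^{-n}(0)=S^{-(n+1)}(0)$, where $S^{-n}(0)$ denotes the null space of $S^n$ ($\mathrm{asc}(S)=\infty$ if there is no such $n$), and $H_0(S)=\{x:\lim_{n\to\infty}\|S^nx\|^{1/n}=0\}$. Suppose that $T$ is left polaroid: for every $\lambda\in\mathrm{iso}\,\sigma_a(T)$, $d(\lambda):=\mathrm{asc}(T-\lambda)$ is finite and $(T-\lambda)^{d(\lambda)+1}\mathcal X$ is closed. Suppose also that $T$ satisfies property (P): for every $\lambda\in\mathrm{iso}\,\sigma_a(T)$, the closed subspace $(T-\lambda)^{-d(\lambda)}(0)+(T-\lambda)\mathcal X$ is complemented in $\mathcal X$, that is, it is the range of a continuous linear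 projection on $\mathcal X$. Then for every $\lambda\in\mathrm{iso}\,\sigma_a(T)$ there exist $T$-invariant closed subspaces $E_1$ and $E_2$ of $\mathcal X$ such that $\mathcal X=E_1\oplus E_2$, $$H_0(T-\lambda)=(T-\lambda)^{-d(\lambda)}(0)=H_0\big((T-\lambda)|_{E_1}\big),$$ and $(T-\lambda)|_{E_2}$ is bounded below. -/

import Mathlib

open Filter Topology

namespace PolarOp

variable {V W : Type*} [NormedAddCommGroup V] [NormedSpace ℂ V]
  [NormedAddCommGroup W] [NormedSpace ℂ W]

/-- The operator `S` is bounded below: it is injective and its range is closed. -/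
def IsBoundedBelow (S : V →L[ℂ] W) : Prop :=
  (∀ x, S x = 0 → x = 0) ∧ IsClosed (Set.range S)

/-- The operator `T - c I`. -/
noncomputable def shift (T : V →L[ℂ] V) (c : ℂ) : V →L[ℂ] V :=
  T - c • ContinuousLinearMap.id ℂ V

/-- The approximate point spectrum of `T`. -/
def approxPointSpectrum (T : V →L[ℂ] V) : Set ℂ :=
  {c | ¬ IsBoundedBelow (shift T c)}

/-- The isolated points of a set of complex numbers: its points that are not limit points. -/
def isoPoints (M : Set ℂ) : Set ℂ := M \ derivedSet M

/-- The null space of `S ^ n`, written `S ^ {-n}(0)`. -/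
def kerPow (S : V →L[ℂ] V) (n : ℕ) : Submodule ℂ V :=
  LinearMap.ker (S ^ n : V →L[ℂ] V).toLinearMap

/-- The ascent of `S`: the least `n` such that the null spaces of `S ^ n` and `S ^ (n + 1)`
coincide, and `⊤` if there is no such `n`. -/
noncomputable def ascent (S : V →L[ℂ] V) : ℕ∞ :=
  sInf ((fun n : ℕ => (n : ℕ∞)) '' {n : ℕ | kerPow S n = kerPow S (n + 1)})

/-- `T` is left polar of order `d` at the point `c` of its approximate point spectrum. -/
def IsLeftPolarAt (T : V →L[ℂ] V) (c : ℂ) (d : ℕ) : Prop :=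
  c ∈ approxPointSpectrum T ∧ ascent (shift T c) = d ∧
    IsClosed (Set.range (shift T c ^ (d + 1) : V →L[ℂ] V))

/-- `T` is left polaroid: it is left polar at every isolated point of its approximate point
spectrum. -/
def IsLeftPolaroid (T : V →L[ℂ] V) : Prop :=
  ∀ c ∈ isoPoints (approxPointSpectrum T), ∃ d : ℕ, IsLeftPolarAt T c d

/-- Property (P): at every isolated point `c` of the approximate point spectrum, with `d` the order
of the left pole `c`, the subspace `(T - c)^{-d}(0) + (T - c) V` is complemented, that is, it is the
range of a continuous linear projection (in particular, it is closed). -/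
def PropertyP (T : V →L[ℂ] V) : Prop :=
  ∀ c ∈ isoPoints (approxPointSpectrum T), ∀ d : ℕ, IsLeftPolarAt T c d →
    (kerPow (shift T c) d ⊔ LinearMap.range (shift T c).toLinearMap).ClosedComplemented

/-- The quasi-nilpotent part `H₀(S)`. -/
def quasiNilpotentPart (S : V →L[ℂ] V) : Set V :=
  {x | Tendsto (fun n : ℕ => ‖(S ^ n) x‖ ^ (1 / (n : ℝ))) atTop (𝓝 0)}

theorem mapsTo_shift {T : V →L[ℂ] V} {E : Submodule ℂ V} (h : Set.MapsTo T E E) (c : ℂ) :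
    Set.MapsTo (shift T c) E E := by
  intro x hx
  exact E.sub_mem (h hx) (E.smul_mem c hx)

/-- The restriction `(T - c)|_E`, as an operator on the `T`-invariant subspace `E`. -/
noncomputable def shiftRestrict (T : V →L[ℂ] V) (c : ℂ) (E : Submodule ℂ V)
    (h : Set.MapsTo T E E) : E →L[ℂ] E :=
  (shift T c).restrict (mapsTo_shift h c)

end PolarOp

namespace PolarOp

variable {V W : Type*} [NormedAddCommGroup V] [NormedSpace ℂ V]
  [NormedAddCommGroup W] [NormedSpace ℂ W]

/-! Put `S = T - c`, `N = ker S ^ d`, and let `π` be the quotient map onto `V ⧸ N`. Finite ascent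
makes the operator `A` induced by `S` injective, and complementing `N + range S` makes `range A`
complemented, so `A` has a left inverse `L` and `1 - A L` lifts to `V`. As `S ^ d` kills `N`, this
lift can be corrected to a section `s` of `π` commuting with the operators
(`exists_intertwining_section`). Then `P = s π` is a projection commuting with `S`, with kernel `N`,
and `K = s L π` inverts `S` on its range. From `P x = K ^ n P S ^ n x` it follows that `P` kills
`H₀(S)`, so `H₀(S) = N`. -/

theorem map_pow_apply_of_intertwine {S : V →L[ℂ] V} {A : W →L[ℂ] W} {f : V →L[ℂ] W}
    (h : ∀ x, f (S x) = A (f x)) (n : ℕ) (x : V) : f ((S ^ n) x) = (A ^ n) (f x) := by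
  induction n generalizing x with
  | zero => rfl
  | succ n ih => rw [pow_succ, pow_succ, mul_apply_eq_comp, mul_apply_eq_comp, ih, h]

/-- If `A` has a left inverse `L` such that `1 - A L` lifts along the surjection `π` intertwining
`S` and `A`, and `S ^ d` factors through `π`, then `π` has a section intertwining `A` and `S`. -/
theorem exists_intertwining_section (S : V →L[ℂ] V) (A L : W →L[ℂ] W) (π : V →L[ℂ] W)
    (j q : W →L[ℂ] V) (d : ℕ) (hπ : Function.Surjective π) (hSA : ∀ x, π (S x) = A (π x))
    (hj : ∀ x, j (π x) = (S ^ d) x) (hLA : ∀ y, L (A y) = y) (hq : ∀ y, q (A y) = 0)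
    (hAL : ∀ y, π (q y) = y - A (L y)) :
    ∃ s : W →L[ℂ] V, (∀ y, π (s y) = y) ∧ ∀ y, S (s y) = s (A y) := by
  have hpow := map_pow_apply_of_intertwine hSA
  have hπj : ∀ y, π (j y) = (A ^ d) y := by
    intro y
    obtain ⟨x, rfl⟩ := hπ y
    rw [hj, hpow]
  have hSj : ∀ y, S (j y) = j (A y) := by
    intro y
    obtain ⟨x, rfl⟩ := hπ y
    rw [← hSA, hj, hj, ← mul_apply_eq_comp, ← mul_apply_eq_comp,
      ← pow_succ, ← pow_succ']
  have hLpow : ∀ n y, L ((L ^ n) (A y)) = (L ^ n) y := by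
    intro n y
    rw [← mul_apply_eq_comp, ← pow_succ', pow_succ, mul_apply_eq_comp, hLA]
  -- Iterating `y = π (q y) + A (L y)` `d` times and lifting each term along `π` gives this section;
  -- `j` lifts `A ^ d`.
  refine ⟨∑ k ∈ Finset.range d, (S ^ k) ∘L q ∘L (L ^ k) + j ∘L (L ^ d), fun y => ?_, fun y => ?_⟩
  · have h : ∀ k, π ((S ^ k) (q ((L ^ k) y))) =
        (A ^ k) ((L ^ k) y) - (A ^ (k + 1)) ((L ^ (k + 1)) y) := by
      intro k
      rw [hpow, hAL, map_sub, pow_succ A, pow_succ' L]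
      rfl
    simp only [add_apply, sum_apply, ContinuousLinearMap.comp_apply, map_add, map_sum, h, hπj]
    rw [Finset.sum_range_sub' fun k => (A ^ k) ((L ^ k) y)]
    exact sub_add_cancel _ _
  · have h : ∀ k, S ((S ^ k) (q ((L ^ k) y))) = (S ^ (k + 1)) (q ((L ^ (k + 1)) (A y))) := by
      intro k
      rw [pow_succ' S, pow_succ' L, mul_apply_eq_comp, mul_apply_eq_comp,
        hLpow]
    -- Index shift: the `k = 0` term on the right vanishes because `q A = 0`.
    have h' : ∑ k ∈ Finset.range d, (S ^ (k + 1)) (q ((L ^ (k + 1)) (A y))) =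
        ∑ k ∈ Finset.range d, (S ^ k) (q ((L ^ k) (A y))) + (S ^ d) (q ((L ^ d) (A y))) := by
      rw [← Finset.sum_range_succ, Finset.sum_range_succ' _ d]
      simp [hq]
    -- By `S ^ d = j π`, the boundary term is exactly the defect between `j L ^ d A` and `j A L ^
    -- d`.
    have h'' : (S ^ d) (q ((L ^ d) (A y))) = j ((L ^ d) (A y)) - j (A ((L ^ d) y)) := by
      rw [← hj, hAL, hLpow, map_sub]
    simp only [add_apply, sum_apply,
      ContinuousLinearMap.comp_apply, map_add, map_sum, h, h', h'', hSj]
    abel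

/-- If the null spaces of `S ^ d` and `S ^ (d + 1)` agree and `ker (S ^ d) + range S` is
complemented, then some continuous projection commuting with `S` has kernel `ker (S ^ d)`, and `S`
has a continuous left inverse on its range. -/
theorem exists_commuting_projection [CompleteSpace V] (S : V →L[ℂ] V) (d : ℕ)
    (hd : kerPow S d = kerPow S (d + 1))
    (hc : (kerPow S d ⊔ LinearMap.range S.toLinearMap).ClosedComplemented) :
    ∃ P K : V →L[ℂ] V, (∀ x, P (P x) = P x) ∧ (∀ x, P x = 0 ↔ x ∈ kerPow S d) ∧
      (∀ x, P (S x) = S (P x)) ∧ (∀ x, P (K x) = K x) ∧ ∀ x, K (S (P x)) = P x := by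
  set N := kerPow S d
  have : IsClosed (N : Set V) := (S ^ d).isClosed_ker
  have hmem' : ∀ x, S x ∈ N ↔ x ∈ N := by
    intro x
    conv_rhs => rw [hd]
    change (S ^ d) (S x) = 0 ↔ (S ^ (d + 1)) x = 0
    rw [pow_succ, mul_apply_eq_comp]
  have hπ0 : ∀ x, N.mkQL x = 0 ↔ x ∈ N := by simp
  have hπ : Function.Surjective N.mkQL := N.mkQ_surjective
  set M := N ⊔ LinearMap.range S.toLinearMap
  obtain ⟨p, hp⟩ := hc
  let A : (V ⧸ N) →L[ℂ] (V ⧸ N) := N.liftQL (N.mkQL ∘L S) fun x hx =>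
    (hπ0 (S x)).2 ((hmem' x).2 hx)
  let j : (V ⧸ N) →L[ℂ] V := N.liftQL (S ^ d) le_rfl
  -- `1 - p` descends to the quotient because `p` fixes `M ⊇ N`.
  let q : (V ⧸ N) →L[ℂ] V := N.liftQL (ContinuousLinearMap.id ℂ V - M.subtypeL ∘L p) fun x hx => by
    have := congrArg Subtype.val (hp ⟨x, le_sup_left (b := LinearMap.range S.toLinearMap) hx⟩)
    exact sub_eq_zero.2 this.symm
  have hA : ∀ x, A (N.mkQL x) = N.mkQL (S x) := fun x => rfl
  have hj : ∀ x, j (N.mkQL x) = (S ^ d) x := fun x => rfl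
  have hq : ∀ x, q (N.mkQL x) = x - p x := fun x => rfl
  have hAinj : Function.Injective A := by
    refine (injective_iff_map_eq_zero A).2 fun y hy => ?_
    obtain ⟨x, rfl⟩ := hπ y
    rwa [hA, hπ0, hmem', ← hπ0] at hy
  have hqA : ∀ y, q (A y) = 0 := by
    intro y
    obtain ⟨x, rfl⟩ := hπ y
    rw [hA, hq, hp ⟨S x, le_sup_right (a := N) ⟨x, rfl⟩⟩, sub_self]
  have hrange : ∀ y, y - N.mkQL (q y) ∈ A.range := by
    intro y
    obtain ⟨x, rfl⟩ := hπ y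
    rw [hq, ← map_sub, sub_sub_cancel]
    obtain ⟨n, hn, _, ⟨z, rfl⟩, h⟩ := Submodule.mem_sup.1 (p x).2
    refine ⟨N.mkQL z, ?_⟩
    rw [← h, map_add, (hπ0 n).2 hn, zero_add]
    rfl
  have hclosed : IsClosed (Set.range A) := by
    have : Set.range A = {y | N.mkQL (q y) = 0} := by
      ext y
      constructor
      · rintro ⟨z, rfl⟩
        simp [hqA]
      · intro hy
        have := hrange y
        rwa [show N.mkQL (q y) = 0 from hy, sub_zero] at this
    rw [this]
    exact (N.mkQL ∘L q).isClosed_ker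
  let L : (V ⧸ N) →L[ℂ] (V ⧸ N) := (A.equivRange hAinj hclosed).symm.toContinuousLinearMap ∘L
    (ContinuousLinearMap.id ℂ (V ⧸ N) - N.mkQL ∘L q).codRestrict A.range hrange
  have hAL : ∀ y, A (L y) = y - N.mkQL (q y) := fun y =>
    congrArg Subtype.val ((A.equivRange hAinj hclosed).apply_symm_apply ⟨_, hrange y⟩)
  have hLA : ∀ y, L (A y) = y := fun y => hAinj (by rw [hAL, hqA, map_zero, sub_zero])
  obtain ⟨s, hs, hsS⟩ := exists_intertwining_section S A L N.mkQL j q d hπ (fun x => (hA x).symm)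
    hj hLA hqA (fun y => by rw [hAL, sub_sub_cancel])
  refine ⟨s ∘L N.mkQL, s ∘L L ∘L N.mkQL, fun x => ?_, fun x => ?_, fun x => ?_, fun x => ?_,
    fun x => ?_⟩
  · simp only [ContinuousLinearMap.comp_apply, hs]
  · rw [← hπ0]
    refine ⟨fun h => ?_, fun h => ?_⟩
    · rw [← hs (N.mkQL x)]
      exact (congrArg N.mkQL h).trans (map_zero _)
    · rw [ContinuousLinearMap.comp_apply, h, map_zero]
  · simp only [ContinuousLinearMap.comp_apply, ← hA, hsS]
  · simp only [ContinuousLinearMap.comp_apply, hs]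
  · simp only [ContinuousLinearMap.comp_apply, hsS, hs, hLA]

theorem mem_quasiNilpotentPart_of_pow_eq_zero {S : V →L[ℂ] V} {x : V} {d : ℕ}
    (hx : (S ^ d) x = 0) : x ∈ quasiNilpotentPart S := by
  refine tendsto_const_nhds.congr' ?_
  -- `n ≥ 1` is needed: at `n = 0` the exponent `1 / 0` is `0`, and `0 ^ 0 = 1`.
  filter_upwards [eventually_ge_atTop (max d 1)] with n hn
  have hdn : d ≤ n := le_of_max_le_left hn
  have hn0 : (n : ℝ) ≠ 0 := by
    have := le_of_max_le_right hn
    positivity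
  have : (S ^ n) x = 0 := by
    rw [← Nat.sub_add_cancel hdn, pow_add, mul_apply_eq_comp, hx, map_zero]
  rw [this, norm_zero, Real.zero_rpow (one_div_ne_zero hn0)]

/-- A vector of the quasi-nilpotent part of `S` is annihilated by every projection that commutes
with `S` and on whose range `S` has a continuous left inverse. -/
theorem projection_eq_zero_of_mem_quasiNilpotentPart {S P K : V →L[ℂ] V}
    (hP : ∀ x, P (S x) = S (P x)) (hK : ∀ x, K (S (P x)) = P x) {x : V}
    (hx : x ∈ quasiNilpotentPart S) : P x = 0 := by
  have hpow := map_pow_apply_of_intertwine hP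
  have hKpow : ∀ n, (K ^ n) ((S ^ n) (P x)) = P x := by
    intro n
    induction n with
    | zero => simp
    | succ n ih =>
      rw [pow_succ, pow_succ', mul_apply_eq_comp, mul_apply_eq_comp,
        ← hpow, hK, hpow, ih]
  have hbound : ∀ n, 0 < n → ‖P x‖ ≤ ‖K‖ ^ n * (‖P‖ * ‖(S ^ n) x‖) := by
    intro n hn
    calc ‖P x‖ = ‖(K ^ n) (P ((S ^ n) x))‖ := by rw [hpow, hKpow]
      _ ≤ ‖K ^ n‖ * ‖P ((S ^ n) x)‖ := (K ^ n).le_opNorm _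
      _ ≤ ‖K‖ ^ n * (‖P‖ * ‖(S ^ n) x‖) := by
        gcongr
        · exact norm_pow_le' K hn
        · exact P.le_opNorm _
  -- Chosen so that `‖K‖ * ε ≤ 1 / 2`; the `+ 1` covers `K = 0`.
  set ε : ℝ := (2 * (‖K‖ + 1))⁻¹ with hε
  have hε0 : 0 < ε := by positivity
  have hKε : ‖K‖ * ε ≤ 1 / 2 := by
    rw [hε, ← div_eq_mul_inv, div_le_div_iff₀ (by positivity) (by norm_num)]
    linarith
  have hev : ∀ᶠ n : ℕ in atTop, ‖P x‖ ≤ ‖P‖ * (1 / 2) ^ n := by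
    filter_upwards [(tendsto_order.1 hx).2 ε hε0, eventually_ge_atTop 1] with n hn hn1
    have hn0 : n ≠ 0 := Nat.one_le_iff_ne_zero.1 hn1
    have h : ‖(S ^ n) x‖ ≤ ε ^ n := by
      rw [one_div] at hn
      rw [← Real.rpow_inv_natCast_pow (norm_nonneg ((S ^ n) x)) hn0]
      exact pow_le_pow_left₀ (by positivity) hn.le n
    calc ‖P x‖ ≤ ‖K‖ ^ n * (‖P‖ * ε ^ n) := (hbound n hn1).trans (by gcongr)
      _ = ‖P‖ * (‖K‖ * ε) ^ n := by rw [mul_pow]; ring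
      _ ≤ ‖P‖ * (1 / 2) ^ n := by gcongr
  have hlim : Tendsto (fun n : ℕ => ‖P‖ * (1 / 2 : ℝ) ^ n) atTop (𝓝 (‖P‖ * 0)) :=
    (tendsto_pow_atTop_nhds_zero_of_lt_one (by norm_num) (by norm_num)).const_mul _
  rw [mul_zero] at hlim
  exact norm_le_zero_iff.1 (ge_of_tendsto hlim hev)

theorem isBoundedBelow_of_hasLeftInverse {S : V →L[ℂ] W} (h : S.HasLeftInverse) :
    IsBoundedBelow S :=
  ⟨fun _ hx => h.injective (hx.trans (map_zero S).symm), h.isClosed_range⟩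

theorem kerPow_eq_of_ascent_eq {S : V →L[ℂ] V} {d : ℕ} (h : ascent S = d) :
    kerPow S d = kerPow S (d + 1) := by
  have hne : ((fun n : ℕ => (n : ℕ∞)) '' {n : ℕ | kerPow S n = kerPow S (n + 1)}).Nonempty := by
    by_contra hempty
    rw [ascent, Set.not_nonempty_iff_eq_empty.1 hempty, sInf_empty] at h
    exact ENat.top_ne_natCast d h
  obtain ⟨n, hn, hnd⟩ := csInf_mem hne
  have : n = d := Nat.cast_injective (R := ℕ∞) (hnd.trans h)
  exact this ▸ hn

theorem shift_apply (T : V →L[ℂ] V) (c : ℂ) (x : V) : shift T c x = T x - c • x := rfl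

theorem mapsTo_of_mapsTo_shift {T : V →L[ℂ] V} {c : ℂ} {E : Submodule ℂ V}
    (h : Set.MapsTo (shift T c) E E) : Set.MapsTo T E E := by
  intro x hx
  have := E.add_mem (h hx) (E.smul_mem c hx)
  rwa [shift_apply, sub_add_cancel] at this

theorem coe_shiftRestrict_pow_apply {T : V →L[ℂ] V} {c : ℂ} {E : Submodule ℂ V}
    (h : Set.MapsTo T E E) (n : ℕ) (x : E) :
    ((shiftRestrict T c E h ^ n) x : V) = (shift T c ^ n) x := by
  induction n generalizing x with
  | zero => rfl
  | succ n ih =>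
    rw [pow_succ, pow_succ, mul_apply_eq_comp, mul_apply_eq_comp, ih]
    rfl

/-- If the ascent of `T - c` is the natural number `d` and `ker (T - c) ^ d + range (T - c)` is
complemented, then `ker (T - c) ^ d` is the quasi-nilpotent part of `T - c`, and it has a closed
`T`-invariant complement on which `T - c` is bounded below. -/
theorem exists_isCompl_kerPow [CompleteSpace V] (T : V →L[ℂ] V) (c : ℂ) (d : ℕ)
    (hd : ascent (shift T c) = d)
    (hc : (kerPow (shift T c) d ⊔ LinearMap.range (shift T c).toLinearMap).ClosedComplemented) :
    quasiNilpotentPart (shift T c) = (kerPow (shift T c) d : Set V) ∧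
      ∃ (E : Submodule ℂ V) (hE : Set.MapsTo T E E), IsClosed (E : Set V) ∧
        IsCompl (kerPow (shift T c) d) E ∧ IsBoundedBelow (shiftRestrict T c E hE) := by
  obtain ⟨P, K, hPP, hP0, hPS, hPK, hKS⟩ :=
    exists_commuting_projection (shift T c) d (kerPow_eq_of_ascent_eq hd) hc
  let E : Submodule ℂ V := LinearMap.ker (ContinuousLinearMap.id ℂ V - P).toLinearMap
  have hE : ∀ x, x ∈ E ↔ P x = x := fun x => by
    change x - P x = 0 ↔ _
    rw [sub_eq_zero, eq_comm]
  have hS : Set.MapsTo (shift T c) E E := fun x hx =>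
    (hE _).2 ((hPS x).trans (congrArg _ ((hE x).1 hx)))
  refine ⟨Set.Subset.antisymm (fun x hx => (hP0 x).1
    (projection_eq_zero_of_mem_quasiNilpotentPart hPS hKS hx))
    fun x hx => mem_quasiNilpotentPart_of_pow_eq_zero hx, E, mapsTo_of_mapsTo_shift hS,
    (ContinuousLinearMap.id ℂ V - P).isClosed_ker, ?_, ?_⟩
  · refine IsCompl.of_eq ((Submodule.eq_bot_iff _).2 fun x hx => ?_)
      ((Submodule.eq_top_iff').2 fun x => ?_)
    · rw [← (hE x).1 hx.2, (hP0 x).2 hx.1]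
    · refine Submodule.mem_sup.2 ⟨x - P x, (hP0 _).1 ?_, P x, (hE _).2 (hPP x),
        sub_add_cancel _ _⟩
      rw [map_sub, hPP, sub_self]
  · refine isBoundedBelow_of_hasLeftInverse
      ⟨(K ∘L E.subtypeL).codRestrict E fun x => (hE _).2 (hPK x), fun x => Subtype.ext ?_⟩
    change K (shift T c x) = x
    have := hKS x
    rwa [(hE x).1 x.2] at this

end PolarOp

open PolarOp in
theorem mainTheorem9 {X : Type*} [NormedAddCommGroup X] [NormedSpace ℂ X] [CompleteSpace X]
    (T : X →L[ℂ] X) (hT : IsLeftPolaroid T) (hP : PropertyP T) :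
    ∀ c ∈ isoPoints (approxPointSpectrum T),
      ∃ d : ℕ, IsLeftPolarAt T c d ∧
        ∃ (E₁ E₂ : Submodule ℂ X) (h₁ : Set.MapsTo T E₁ E₁) (h₂ : Set.MapsTo T E₂ E₂),
          IsClosed (E₁ : Set X) ∧ IsClosed (E₂ : Set X) ∧ IsCompl E₁ E₂ ∧
          quasiNilpotentPart (shift T c) = (kerPow (shift T c) d : Set X) ∧
          (kerPow (shift T c) d : Set X) =
            Subtype.val '' quasiNilpotentPart (shiftRestrict T c E₁ h₁) ∧
          IsBoundedBelow (shiftRestrict T c E₂ h₂) := by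
  intro c hc
  obtain ⟨d, hd⟩ := hT c hc
  obtain ⟨hH, E, hE, hEclosed, hcompl, hbelow⟩ :=
    exists_isCompl_kerPow T c d hd.2.1 (hP c hc d hd)
  have hpow : ∀ x ∈ kerPow (shift T c) d, (shift T c ^ d) x = 0 := fun x hx => hx
  have hN : Set.MapsTo T (kerPow (shift T c) d) (kerPow (shift T c) d) := by
    refine mapsTo_of_mapsTo_shift (c := c) fun x hx => ?_
    change (shift T c ^ d) (shift T c x) = 0
    rw [← mul_apply_eq_comp, ← pow_succ, pow_succ', mul_apply_eq_comp,
      hpow x hx, map_zero]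
  refine ⟨d, hd, kerPow (shift T c) d, E, hN, hE, (shift T c ^ d).isClosed_ker, hEclosed, hcompl,
    hH, ?_, hbelow⟩
  ext x
  -- On `E₁ = ker (T - c) ^ d` the restriction is nilpotent, so its quasi-nilpotent part is all of
  -- `E₁`.
  refine ⟨fun hx => ⟨⟨x, hx⟩, mem_quasiNilpotentPart_of_pow_eq_zero (d := d) ?_, rfl⟩, ?_⟩
  · exact Subtype.ext ((coe_shiftRestrict_pow_apply hN d ⟨x, hx⟩).trans (hpow x hx))
  · rintro ⟨y, -, rfl⟩
    exact y.2
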